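/- A Boolean function is a function $f\colon\{0,1\}^n\to\{0,1\}$ with $n\ge 1$. Its rational degree $\mathrm{rdeg}(f)$ is the minimum of $\max(\deg p,\deg q)$ over all pairs of real multilinear polynomials $p,q\in\mathbb R[X_1,\dots,X_n]$ such that $q(x)\ne 0$ and $p(x)/q(x)=f(x)$ for all $x\in\{0,1\}^n$. A $T$-query postselected quantum algorithm acts on finitely many qubits, with basis states $|a\rangle|b\rangle|i\rangle|t\rangle|z\rangle$, where $a,b,t$ are single qubits, $i$ is an index register of $\lceil\log_2 n\rceil$ qubits, and $z$ is an arbitrary number of work qubits. On input $x\in\{0,1\}^n$ it prepares the state $U_T O_x U_{T-1} O_x\cdots O_x U_0|0\cdots 0\rangle$, where the unitaries $U_0,\dots,U_T$ do not depend on $x$ and $O_x|a,b,i,t,z\rangle=|a,b,i,t\oplus x_i,z\rangle$ (with $O_x$ acting as the identity on those $i$ that are not the address of an input bit). It then measures the first two qubits: $a$ is the postselection bit and $b$ the output bit. The algorithm computes $f$ with error at most $\epsilon$ if for every $x\in\{0,1\}^n$ we have $\Pr[a=1]>0$ and $\Pr[b=f(x)\mid a=1]\ge 1-\epsilon$. Let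 $\mathrm{PostQ}_\epsilon(f)$ be the minimum $T$ for which such an algorithm with $T$ queries exists. Then for every Boolean function $f$, both minima $\mathrm{rdeg}(f)$ and $\mathrm{PostQ}_0(f)$ exist (that is, they are taken over nonempty sets), and $$\mathrm{rdeg}(f)=\mathrm{PostQ}_0(f).$$ -/

import Mathlib

/-- A bit, as a real number. -/
def bitVal (b : Bool) : ℝ := if b then 1 else 0

/-- `p / q` is a rational representation of `f`: `p`, `q` are multilinear real polynomials,
`q` has no zero on the cube, and `p / q = f` on the cube. -/
def IsRationalRep {n : ℕ} (f : (Fin n → Bool) → Bool) (p q : MvPolynomial (Fin n) ℝ) : Prop :=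
  p ∈ MvPolynomial.restrictDegree (Fin n) ℝ 1 ∧
  q ∈ MvPolynomial.restrictDegree (Fin n) ℝ 1 ∧
  ∀ x : Fin n → Bool,
    MvPolynomial.eval (fun i => bitVal (x i)) q ≠ 0 ∧
    MvPolynomial.eval (fun i => bitVal (x i)) p / MvPolynomial.eval (fun i => bitVal (x i)) q
      = bitVal (f x)

/-- The degrees `max (deg p) (deg q)` of the rational representations `p / q` of `f`. -/
def rationalRepDegrees {n : ℕ} (f : (Fin n → Bool) → Bool) : Set ℕ :=
  {d | ∃ p q : MvPolynomial (Fin n) ℝ,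
    IsRationalRep f p q ∧ d = max p.totalDegree q.totalDegree}

/-- The rational degree of `f`. -/
noncomputable def rdeg {n : ℕ} (f : (Fin n → Bool) → Bool) : ℕ :=
  sInf (rationalRepDegrees f)

/-- Computational basis states of the qubits of a query algorithm on `n`-bit inputs.
In order: the postselection qubit, the output qubit, the `⌈log₂ n⌉` qubits of the index
register, the target qubit of the query, and `w` further work qubits. -/
abbrev QBasis (n w : ℕ) : Type :=
  Bool × Bool × (Fin (Nat.clog 2 n) → Bool) × Bool × (Fin w → Bool)

/-- The bit of `x` at address `j`; addresses outside the input read `false`, so that a query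
at such an address acts as the identity. -/
def bitAt {n : ℕ} (x : Fin n → Bool) (j : ℕ) : Bool :=
  if h : j < n then x ⟨j, h⟩ else false

/-- The action of a query on basis states: `|a, b, i, t, z⟩ ↦ |a, b, i, t ⊕ xᵢ, z⟩`. -/
def queryBasis {n w : ℕ} (x : Fin n → Bool) (s : QBasis n w) : QBasis n w :=
  (s.1, s.2.1, s.2.2.1, xor s.2.2.2.1 (bitAt x (Nat.ofBits s.2.2.1)), s.2.2.2.2)

/-- The query operator `O_x`, as a matrix: it sends `|s⟩` to `|queryBasis x s⟩`. -/
def oracle {n : ℕ} (w : ℕ) (x : Fin n → Bool) : Matrix (QBasis n w) (QBasis n w) ℂ :=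
  Matrix.of fun s s' => if s = queryBasis x s' then 1 else 0

/-- The all-zero basis state `|0…0⟩`. -/
def zeroBasis (n w : ℕ) : QBasis n w :=
  (false, false, fun _ => false, false, fun _ => false)

/-- A postselected quantum query algorithm on `n`-bit inputs: a number of work qubits, a number
of queries `T`, and input-independent unitaries. Only `U 0, …, U T` are ever applied. -/
structure PostselAlg (n : ℕ) where
  work : ℕ
  queries : ℕ
  U : ℕ → Matrix.unitaryGroup (QBasis n work) ℂ

namespace PostselAlg

variable {n : ℕ}

/-- The state `U_t O_x U_{t-1} O_x ⋯ O_x U_0 |0…0⟩`, which uses `t` queries. -/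
noncomputable def stateAfter (A : PostselAlg n) (x : Fin n → Bool) : ℕ → QBasis n A.work → ℂ
  | 0 => Matrix.mulVec (A.U 0 : Matrix (QBasis n A.work) (QBasis n A.work) ℂ)
      (Pi.single (zeroBasis n A.work) 1)
  | t + 1 => Matrix.mulVec (A.U (t + 1) : Matrix (QBasis n A.work) (QBasis n A.work) ℂ)
      (Matrix.mulVec (oracle A.work x) (A.stateAfter x t))

/-- The state of the algorithm on input `x` just before postselection. -/
noncomputable def finalState (A : PostselAlg n) (x : Fin n → Bool) : QBasis n A.work → ℂ :=
  A.stateAfter x A.queries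

/-- The probability that measuring the first two qubits of the final state
gives `1` (postselection succeeds) and `b`. -/
noncomputable def jointProb (A : PostselAlg n) (x : Fin n → Bool) (b : Bool) : ℝ :=
  ∑ s : QBasis n A.work, if s.1 = true ∧ s.2.1 = b then ‖A.finalState x s‖ ^ 2 else 0

/-- The probability that the postselection qubit of the final state is measured as `1`. -/
noncomputable def postProb (A : PostselAlg n) (x : Fin n → Bool) : ℝ :=
  ∑ s : QBasis n A.work, if s.1 = true then ‖A.finalState x s‖ ^ 2 else 0

/-- `A` computes `f` with error at most `ε`: on every input, postselection succeeds with positive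
probability and, conditioned on that, the output is `f x` with probability at least `1 - ε`. -/
def Computes (A : PostselAlg n) (ε : ℝ) (f : (Fin n → Bool) → Bool) : Prop :=
  ∀ x : Fin n → Bool, 0 < A.postProb x ∧ 1 - ε ≤ A.jointProb x (f x) / A.postProb x

end PostselAlg

/-- The numbers of queries of the postselected algorithms computing `f` with error at most `ε`. -/
def postQueryCounts {n : ℕ} (ε : ℝ) (f : (Fin n → Bool) → Bool) : Set ℕ :=
  {T | ∃ A : PostselAlg n, A.Computes ε f ∧ T = A.queries}

/-- The `ε`-error postselected quantum query complexity of `f`. -/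
noncomputable def PostQ {n : ℕ} (ε : ℝ) (f : (Fin n → Bool) → Bool) : ℕ :=
  sInf (postQueryCounts ε f)

/-! Lower bound on queries: a query acts on the state by an operator affine in the bits of `x`, so
amplitudes after `T` queries have degree at most `T`. Probabilities would have degree `2 * T`, but
zero error permits working with amplitudes: postselected amplitudes with the wrong output vanish.
Apply one generic real functional `φ` to the postselected part of the state for the denominator, and
to its output-`1` part for the numerator; the two agree where `f = 1`, and the numerator vanishes
where `f = 0`.

Upper bound: given `p / q` of degree `d`, write `p` and `q - p` on the cube as real combinations of
products of `d` phases `±1`. A superposition over these products, weighted by the coefficients,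
picks up the phases in `d` queries. Projecting onto uniform superpositions then leaves postselected
amplitudes proportional to `p` for output `1` and to `q - p` for output `0`. Exactly one of them
vanishes, according to `f`.

The two halves are `exists_rationalRepDegree_le_queries` and
`mem_postQueryCounts_of_rationalRepDegrees`. -/

/-! ### Polynomial functions on the cube. -/

/-- The value of the multilinear monomial `∏ i ∈ S, X i` on the cube. -/
def cubeMonomial {n : ℕ} (S : Finset (Fin n)) (x : Fin n → Bool) : ℝ :=
  ∏ i ∈ S, bitVal (x i)

/-- The real functions on the cube that are polynomials of degree at most `d`. -/
def cubePoly (n d : ℕ) : Submodule ℝ ((Fin n → Bool) → ℝ) :=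
  Submodule.span ℝ (cubeMonomial '' {S | S.card ≤ d})

theorem bitVal_mul_self (b : Bool) : bitVal b * bitVal b = bitVal b := by
  cases b <;> simp [bitVal]

theorem bitVal_pow (b : Bool) {k : ℕ} (hk : k ≠ 0) : bitVal b ^ k = bitVal b := by
  cases b <;> simp [bitVal, hk]

theorem cubeMonomial_mem {n d : ℕ} {S : Finset (Fin n)} (hS : S.card ≤ d) :
    cubeMonomial S ∈ cubePoly n d :=
  Submodule.subset_span ⟨S, hS, rfl⟩

theorem cubePoly_mono {n d e : ℕ} (h : d ≤ e) : cubePoly n d ≤ cubePoly n e :=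
  Submodule.span_mono (Set.image_mono fun _ hS => le_trans hS h)

theorem const_mem_cubePoly {n d : ℕ} (c : ℝ) : (fun _ => c) ∈ cubePoly n d := by
  have h := (cubePoly n d).smul_mem c (cubeMonomial_mem (S := ∅) (by simp))
  convert h using 1
  ext x
  simp [cubeMonomial]

/-- Bits are idempotent, so the product with a monomial is again squarefree; this gives one degree
per query. -/
theorem bitVal_mul_mem_cubePoly {n d : ℕ} (i : Fin n) {F : (Fin n → Bool) → ℝ}
    (hF : F ∈ cubePoly n d) : (fun x => bitVal (x i) * F x) ∈ cubePoly n (d + 1) := by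
  induction hF using Submodule.span_induction with
  | mem F hF =>
    obtain ⟨S, hS, rfl⟩ := hF
    have h : (fun x => bitVal (x i) * cubeMonomial S x) = cubeMonomial (insert i S) := by
      ext x
      by_cases hi : i ∈ S
      · rw [Finset.insert_eq_of_mem hi, cubeMonomial, ← Finset.mul_prod_erase S _ hi, ← mul_assoc,
          bitVal_mul_self]
      · rw [cubeMonomial, cubeMonomial, Finset.prod_insert hi]
    rw [h]
    exact cubeMonomial_mem ((Finset.card_insert_le _ _).trans (Nat.succ_le_succ hS))
  | zero => simpa using const_mem_cubePoly 0
  | add F G _ _ hF hG =>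
    convert (cubePoly n (d + 1)).add_mem hF hG using 1
    ext x
    simp [mul_add]
  | smul a F _ hF =>
    convert (cubePoly n (d + 1)).smul_mem a hF using 1
    ext x
    simp [mul_left_comm]

theorem eval_mem_cubePoly {n d : ℕ} {p : MvPolynomial (Fin n) ℝ} (hp : p.totalDegree ≤ d) :
    (fun x => MvPolynomial.eval (fun i => bitVal (x i)) p) ∈ cubePoly n d := by
  have h : (fun x : Fin n → Bool => MvPolynomial.eval (fun i => bitVal (x i)) p) =
      ∑ m ∈ p.support, p.coeff m • cubeMonomial m.support := by
    ext x
    rw [MvPolynomial.eval_eq, Finset.sum_apply]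
    refine Finset.sum_congr rfl fun m _ => ?_
    rw [Pi.smul_apply, smul_eq_mul, cubeMonomial]
    congr 1
    exact Finset.prod_congr rfl fun i hi => bitVal_pow _ (Finsupp.mem_support_iff.mp hi)
  rw [h]
  refine Submodule.sum_mem _ fun m hm => Submodule.smul_mem _ _ (cubeMonomial_mem ?_)
  refine le_trans ?_ ((MvPolynomial.le_totalDegree hm).trans hp)
  rw [Finset.card_eq_sum_ones]
  exact Finset.sum_le_sum fun i hi => Nat.one_le_iff_ne_zero.mpr (Finsupp.mem_support_iff.mp hi)

theorem exists_multilinear_of_mem_cubePoly {n d : ℕ} {F : (Fin n → Bool) → ℝ}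
    (hF : F ∈ cubePoly n d) :
    ∃ p ∈ MvPolynomial.restrictDegree (Fin n) ℝ 1, p.totalDegree ≤ d ∧
      ∀ x : Fin n → Bool, MvPolynomial.eval (fun i => bitVal (x i)) p = F x := by
  induction hF using Submodule.span_induction with
  | mem F hF =>
    obtain ⟨S, hS, rfl⟩ := hF
    have h : (∏ i ∈ S, MvPolynomial.X i : MvPolynomial (Fin n) ℝ) =
        MvPolynomial.monomial (Finsupp.indicator S fun _ _ => 1) 1 := by
      rw [MvPolynomial.monomial_eq, MvPolynomial.C_1, one_mul, Finsupp.prod_fintype _ _ (by simp)]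
      simp [Finsupp.indicator_apply, Finset.prod_ite_mem, pow_ite]
    refine ⟨∏ i ∈ S, MvPolynomial.X i, ?_, ?_, fun x => by simp [cubeMonomial]⟩
    · rw [h, MvPolynomial.mem_restrictDegree]
      intro m hm i
      rw [MvPolynomial.support_monomial, if_neg one_ne_zero, Finset.mem_singleton] at hm
      subst hm
      rw [Finsupp.indicator_apply]
      split_ifs <;> simp
    · refine (MvPolynomial.totalDegree_finsetProd _ _).trans ?_
      simpa using hS
  | zero => exact ⟨0, Submodule.zero_mem _, by simp, by simp⟩
  | add F G _ _ hF hG =>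
    obtain ⟨p, hp, hpd, hpe⟩ := hF
    obtain ⟨q, hq, hqd, hqe⟩ := hG
    exact ⟨p + q, Submodule.add_mem _ hp hq,
      (MvPolynomial.totalDegree_add _ _).trans (max_le hpd hqd), by simp [hpe, hqe]⟩
  | smul a F _ hF =>
    obtain ⟨p, hp, hpd, hpe⟩ := hF
    exact ⟨a • p, Submodule.smul_mem _ _ hp, (MvPolynomial.totalDegree_smul_le _ _).trans hpd,
      by simp [MvPolynomial.smul_eval, hpe]⟩

/-- Every real function on the cube is a polynomial of degree at most the dimension. -/
theorem mem_cubePoly_dim {n : ℕ} (F : (Fin n → Bool) → ℝ) : F ∈ cubePoly n n := by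
  -- The point indicator at `y` is a product of factors `x i` or `1 - x i`.
  have key (y : Fin n → Bool) (S : Finset (Fin n)) :
      (fun x => ∏ i ∈ S, (if x i = y i then (1 : ℝ) else 0)) ∈ cubePoly n S.card := by
    induction S using Finset.induction_on with
    | empty => simpa using const_mem_cubePoly 1
    | insert i S hi ih =>
      rw [Finset.card_insert_of_notMem hi]
      have h1 := bitVal_mul_mem_cubePoly i ih
      have h2 := cubePoly_mono (Nat.le_succ S.card) ih
      cases hy : y i
      · convert (cubePoly n _).sub_mem h2 h1 using 1
        ext x
        rw [Finset.prod_insert hi, hy, Pi.sub_apply]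
        cases x i <;> simp [bitVal]
      · convert h1 using 1
        ext x
        rw [Finset.prod_insert hi, hy]
        cases x i <;> simp [bitVal]
  have h : F = ∑ y, F y • fun x => ∏ i, (if x i = y i then (1 : ℝ) else 0) := by
    ext x
    rw [Finset.sum_apply, Finset.sum_eq_single x]
    · simp
    · intro y _ hyx
      obtain ⟨i, hi⟩ := Function.ne_iff.mp hyx
      rw [Pi.smul_apply, Finset.prod_eq_zero (Finset.mem_univ i) (if_neg (Ne.symm hi)), smul_zero]
    · simp
  rw [h]
  refine Submodule.sum_mem _ fun y _ => Submodule.smul_mem _ _ ?_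
  simpa using key y Finset.univ

/-- Representations of `f` as a quotient of functions of degree at most `d` on the cube give
rational representations of degree at most `d`. -/
theorem exists_rationalRepDegree_le {n d : ℕ} {f : (Fin n → Bool) → Bool}
    {P Q : (Fin n → Bool) → ℝ} (hP : P ∈ cubePoly n d) (hQ : Q ∈ cubePoly n d)
    (hQ0 : ∀ x, Q x ≠ 0) (hf : ∀ x, P x = bitVal (f x) * Q x) :
    ∃ e ∈ rationalRepDegrees f, e ≤ d := by
  obtain ⟨p, hp, hpd, hpe⟩ := exists_multilinear_of_mem_cubePoly hP
  obtain ⟨q, hq, hqd, hqe⟩ := exists_multilinear_of_mem_cubePoly hQ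
  refine ⟨_, ⟨p, q, ⟨hp, hq, fun x => ?_⟩, rfl⟩, max_le hpd hqd⟩
  rw [hpe, hqe, hf]
  exact ⟨hQ0 x, mul_div_cancel_right₀ _ (hQ0 x)⟩

theorem rationalRepDegrees_nonempty {n : ℕ} (f : (Fin n → Bool) → Bool) :
    (rationalRepDegrees f).Nonempty := by
  obtain ⟨e, he, -⟩ := exists_rationalRepDegree_le (f := f) (mem_cubePoly_dim fun x => bitVal (f x))
    (const_mem_cubePoly 1) (fun _ => one_ne_zero) (fun x => (mul_one _).symm)
  exact ⟨e, he⟩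

/-! ### Amplitudes as polynomials, and the lower bound on queries. -/

theorem queryBasis_involutive {n w : ℕ} (x : Fin n → Bool) :
    Function.Involutive (queryBasis (w := w) x) := by
  rintro ⟨a, b, i, t, z⟩
  simp [queryBasis]

theorem oracle_mulVec_apply {n w : ℕ} (x : Fin n → Bool) (v : QBasis n w → ℂ) (s : QBasis n w) :
    (oracle w x).mulVec v s = v (queryBasis x s) := by
  rw [Matrix.mulVec, dotProduct, Finset.sum_eq_single (queryBasis x s)]
  · simp [oracle, queryBasis_involutive x s]
  · intro s' _ hs
    have : s ≠ queryBasis x s' := by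
      rintro rfl
      exact hs (queryBasis_involutive x s').symm
    simp [oracle, this]
  · simp

/-- The change of a state when the target bit is flipped at address `i`. -/
def queryDiff {n : ℕ} (w : ℕ) (i : Fin n) : (QBasis n w → ℂ) →ₗ[ℝ] (QBasis n w → ℂ) where
  toFun v s := if Nat.ofBits s.2.2.1 = i then
    v (s.1, s.2.1, s.2.2.1, !s.2.2.2.1, s.2.2.2.2) - v s else 0
  map_add' u v := by
    ext s
    dsimp only [Pi.add_apply]
    split_ifs
    · ring
    · simp
  map_smul' a v := by
    ext s
    dsimp only [Pi.smul_apply, RingHom.id_apply]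
    split_ifs
    · rw [smul_sub]
    · simp

/-- The oracle is affine in the bits of `x`: each basis state reads at most one of them, and
addresses beyond the input contribute nothing. -/
theorem oracle_mulVec_eq {n w : ℕ} (x : Fin n → Bool) (v : QBasis n w → ℂ) :
    (oracle w x).mulVec v = v + ∑ i, bitVal (x i) • queryDiff w i v := by
  ext s
  rw [oracle_mulVec_apply, Pi.add_apply, Finset.sum_apply]
  obtain ⟨a, b, i, t, z⟩ := s
  by_cases h : Nat.ofBits i < n
  · rw [Finset.sum_eq_single ⟨Nat.ofBits i, h⟩]
    · cases hx : x ⟨Nat.ofBits i, h⟩ <;> simp [queryBasis, bitAt, h, hx, bitVal, queryDiff]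
    · intro j _ hj
      have : Nat.ofBits i ≠ j := fun e => hj (Fin.ext e.symm)
      simp [queryDiff, this]
    · simp
  · rw [Finset.sum_eq_zero]
    · simp [queryBasis, bitAt, h]
    · intro j _
      have : Nat.ofBits i ≠ j := fun e => h (e ▸ j.isLt)
      simp [queryDiff, this]

namespace PostselAlg

variable {n : ℕ}

/-- After `t` queries, every real-linear function of the state has degree at most `t`. -/
theorem linear_stateAfter_mem_cubePoly (A : PostselAlg n) (t : ℕ)
    (φ : (QBasis n A.work → ℂ) →ₗ[ℝ] ℝ) : (fun x => φ (A.stateAfter x t)) ∈ cubePoly n t := by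
  induction t generalizing φ with
  | zero =>
    exact const_mem_cubePoly (φ (Matrix.mulVec
      (A.U 0 : Matrix (QBasis n A.work) (QBasis n A.work) ℂ) (Pi.single (zeroBasis n A.work) 1)))
  | succ t ih =>
    let ψ : (QBasis n A.work → ℂ) →ₗ[ℝ] ℝ := φ ∘ₗ
      (Matrix.mulVecLin (A.U (t + 1) : Matrix (QBasis n A.work) (QBasis n A.work) ℂ)).restrictScalars ℝ
    have h : (fun x => φ (A.stateAfter x (t + 1))) = (fun x => ψ (A.stateAfter x t)) +
        ∑ i, fun x => bitVal (x i) * (ψ ∘ₗ queryDiff A.work i) (A.stateAfter x t) := by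
      ext x
      change ψ ((oracle A.work x).mulVec (A.stateAfter x t)) = _
      rw [oracle_mulVec_eq, map_add, map_sum]
      simp
    rw [h]
    exact Submodule.add_mem _ (cubePoly_mono (Nat.le_succ t) (ih ψ))
      (Submodule.sum_mem _ fun i _ => bitVal_mul_mem_cubePoly i (ih _))

theorem postProb_eq_add (A : PostselAlg n) (x : Fin n → Bool) (b : Bool) :
    A.postProb x = A.jointProb x b + A.jointProb x (!b) := by
  rw [postProb, jointProb, jointProb, ← Finset.sum_add_distrib]
  refine Finset.sum_congr rfl fun s _ => ?_
  obtain ⟨a, c, r⟩ := s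
  cases a <;> cases b <;> cases c <;> simp

theorem jointProb_nonneg (A : PostselAlg n) (x : Fin n → Bool) (b : Bool) :
    0 ≤ A.jointProb x b :=
  Finset.sum_nonneg fun s _ => by split_ifs <;> positivity

theorem jointProb_eq_zero_iff (A : PostselAlg n) (x : Fin n → Bool) (b : Bool) :
    A.jointProb x b = 0 ↔ ∀ s, s.1 = true → s.2.1 = b → A.finalState x s = 0 := by
  rw [jointProb, Finset.sum_eq_zero_iff_of_nonneg fun s _ => by split_ifs <;> positivity]
  simp

/-- Zero error means that postselected amplitudes with the wrong output vanish, and some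
postselected amplitude with the right output does not. -/
theorem computes_zero_iff (A : PostselAlg n) (f : (Fin n → Bool) → Bool) :
    A.Computes 0 f ↔ ∀ x, A.jointProb x (f x) ≠ 0 ∧ A.jointProb x (!f x) = 0 := by
  refine forall_congr' fun x => ?_
  have h0 := A.jointProb_nonneg x (f x)
  have h1 := A.jointProb_nonneg x (!f x)
  rw [A.postProb_eq_add x (f x), sub_zero]
  constructor
  · rintro ⟨h, h'⟩
    rw [one_le_div h] at h'
    have h2 : A.jointProb x (!f x) = 0 := by linarith
    exact ⟨by rw [h2, add_zero] at h; exact h.ne', h2⟩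
  · rintro ⟨h, h'⟩
    rw [h', add_zero, div_self h]
    exact ⟨lt_of_le_of_ne h0 h.symm, le_rfl⟩

end PostselAlg

theorem exists_rationalRepDegree_le_queries {n : ℕ} {f : (Fin n → Bool) → Bool}
    {A : PostselAlg n} (hA : A.Computes 0 f) : ∃ e ∈ rationalRepDegrees f, e ≤ A.queries := by
  rw [PostselAlg.computes_zero_iff] at hA
  let mask (P : QBasis n A.work → Prop) [DecidablePred P] :
      (QBasis n A.work → ℂ) →ₗ[ℝ] (QBasis n A.work → ℂ) :=
    { toFun := fun v s => if P s then v s else 0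
      map_add' := fun u v => by
        ext s
        dsimp only [Pi.add_apply]
        split_ifs <;> simp
      map_smul' := fun a v => by
        ext s
        dsimp only [Pi.smul_apply, RingHom.id_apply]
        split_ifs <;> simp }
  -- Finitely many nonzero vectors can be avoided by the kernel of a single functional; taking it
  -- real-linear keeps the polynomials real.
  obtain ⟨φ, hφ⟩ := Module.exists_dual_forall_apply_ne_zero (K := ℝ)
    (fun x => mask (fun s => s.1 = true) (A.finalState x)) (fun x h => (hA x).1 <| by
      rw [PostselAlg.jointProb_eq_zero_iff]
      intro s hs _
      simpa [mask, hs] using congrFun h s)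
  refine exists_rationalRepDegree_le
    (A.linear_stateAfter_mem_cubePoly A.queries (φ ∘ₗ mask fun s => s.1 = true ∧ s.2.1 = true))
    (A.linear_stateAfter_mem_cubePoly A.queries (φ ∘ₗ mask fun s => s.1 = true)) hφ fun x => ?_
  have h0 := (A.jointProb_eq_zero_iff x (!f x)).mp (hA x).2
  cases hfx : f x
  · rw [hfx] at h0
    have : mask (fun s => s.1 = true ∧ s.2.1 = true) (A.stateAfter x A.queries) = 0 := by
      ext s
      by_cases h : s.1 = true ∧ s.2.1 = true
      · simpa [mask, h, PostselAlg.finalState] using h0 s h.1 h.2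
      · simp [mask, h]
    simp [this, bitVal]
  · rw [hfx] at h0
    have : mask (fun s => s.1 = true ∧ s.2.1 = true) (A.stateAfter x A.queries) =
        mask (fun s => s.1 = true) (A.stateAfter x A.queries) := by
      ext s
      by_cases h : s.1 = true
      · cases h' : s.2.1
        · simpa [mask, h, h', PostselAlg.finalState] using (h0 s h h').symm
        · simp [mask, h, h']
      · simp [mask, h]
    simp [this, bitVal]

/-! ### Expansion in products of query phases. -/

/-- The sign `(-1) ^ xᵢ` of a query at `i`, and `1` when nothing is queried. -/
def queryPhase {n : ℕ} (o : Option (Fin n)) (x : Fin n → Bool) : ℝ :=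
  o.elim 1 fun i => 1 - 2 * bitVal (x i)

/-- The character picked up by the sequence `l` of queries. -/
def queryChar {n d : ℕ} (l : Fin d → Option (Fin n)) (x : Fin n → Bool) : ℝ :=
  ∏ k, queryPhase (l k) x

theorem queryPhase_mul_mem {n d : ℕ} (o : Option (Fin n)) {F : (Fin n → Bool) → ℝ}
    (hF : F ∈ Submodule.span ℝ (Set.range (queryChar (n := n) (d := d)))) :
    (fun x => queryPhase o x * F x) ∈
      Submodule.span ℝ (Set.range (queryChar (n := n) (d := d + 1))) := by
  induction hF using Submodule.span_induction with
  | mem F hF =>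
    obtain ⟨l, rfl⟩ := hF
    refine Submodule.subset_span ⟨Fin.cons o l, ?_⟩
    ext x
    simp [queryChar, Fin.prod_univ_succ]
  | zero =>
    simp only [Pi.zero_apply, mul_zero]
    exact Submodule.zero_mem _
  | add F G _ _ hF hG =>
    convert Submodule.add_mem _ hF hG using 1
    ext x
    simp [mul_add]
  | smul a F _ hF =>
    convert Submodule.smul_mem _ a hF using 1
    ext x
    simp [mul_left_comm]

/-- Sequences are padded by `none`, whose phase is `1`. -/
theorem span_queryChar_le_succ (n d : ℕ) :
    Submodule.span ℝ (Set.range (queryChar (n := n) (d := d))) ≤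
      Submodule.span ℝ (Set.range (queryChar (n := n) (d := d + 1))) := fun F hF => by
  simpa [queryPhase] using queryPhase_mul_mem none hF

theorem cubeMonomial_mem_span_queryChar {n : ℕ} (S : Finset (Fin n)) :
    cubeMonomial S ∈ Submodule.span ℝ (Set.range (queryChar (n := n) (d := S.card))) := by
  induction S using Finset.induction_on with
  | empty =>
    refine Submodule.subset_span ⟨Fin.elim0, ?_⟩
    ext x
    exact (Fin.prod_univ_zero _).trans Finset.prod_empty.symm
  | insert i S hi ih =>
    rw [Finset.card_insert_of_notMem hi]
    -- A bit is `(1 - phase) / 2`.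
    convert Submodule.smul_mem _ (2⁻¹ : ℝ) (Submodule.sub_mem _ (span_queryChar_le_succ _ _ ih)
      (queryPhase_mul_mem (some i) ih)) using 1
    ext x
    simp only [cubeMonomial, Finset.prod_insert hi, queryPhase, Option.elim_some, Pi.smul_apply,
      Pi.sub_apply, smul_eq_mul]
    ring

theorem exists_sum_queryChar {n d : ℕ} {F : (Fin n → Bool) → ℝ} (hF : F ∈ cubePoly n d) :
    ∃ c : (Fin d → Option (Fin n)) → ℝ, ∀ x, F x = ∑ l, c l * queryChar l x := by
  have hle : cubePoly n d ≤ Submodule.span ℝ (Set.range (queryChar (n := n) (d := d))) := by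
    refine Submodule.span_le.mpr ?_
    rintro _ ⟨S, hS, rfl⟩
    exact monotone_nat_of_le_succ (span_queryChar_le_succ n) hS (cubeMonomial_mem_span_queryChar S)
  obtain ⟨c, rfl⟩ := (Submodule.mem_span_range_iff_exists_fun ℝ).mp (hle hF)
  exact ⟨c, fun x => by simp [Finset.sum_apply]⟩

/-! ### Unitaries with prescribed values. -/

section Unitary

open Matrix

variable {B ι : Type*} [Fintype B]

/-- Orthonormality of a family of complex coordinate vectors. -/
def IsOrthonormalFamily [DecidableEq ι] (u : ι → B → ℂ) : Prop :=
  ∀ i j, star (u i) ⬝ᵥ u j = if i = j then 1 else 0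

theorem IsOrthonormalFamily.sum_dotProduct_sum [DecidableEq ι] [Fintype ι] {u : ι → B → ℂ}
    (hu : IsOrthonormalFamily u) (a b : ι → ℂ) :
    star (∑ i, a i • u i) ⬝ᵥ ∑ i, b i • u i = ∑ i, star (a i) * b i := by
  simp only [star_sum, star_smul, sum_dotProduct, dotProduct_sum, smul_dotProduct,
    dotProduct_smul, hu _ _, smul_eq_mul]
  simp [mul_comm]

/-- An orthonormal family can be prescribed as columns of a unitary matrix. -/
theorem exists_unitary_columns [DecidableEq B] [DecidableEq ι] {u : ι → B → ℂ}
    (hu : IsOrthonormalFamily u) (e : ι ↪ B) :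
    ∃ W : unitaryGroup B ℂ, ∀ i s, (W : Matrix B B ℂ) s (e i) = u i s := by
  let v : B → EuclideanSpace ℂ B := fun s =>
    WithLp.toLp 2 (Function.extend e u 0 s)
  have hve (i : ι) : v (e i) = WithLp.toLp 2 (u i) := by
    simp [v, e.injective.extend_apply]
  have hv : Orthonormal ℂ ((Set.range e).domRestrict v) := by
    rw [orthonormal_iff_ite]
    rintro ⟨_, i, rfl⟩ ⟨_, j, rfl⟩
    rw [Set.domRestrict_apply, Set.domRestrict_apply, hve, hve, EuclideanSpace.inner_toLp_toLp,
      dotProduct_comm, hu i j]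
    exact if_congr ⟨fun h => by subst h; rfl, fun h => e.injective (Subtype.mk.inj h)⟩ rfl rfl
  obtain ⟨b, hb⟩ := hv.exists_orthonormalBasis_extension_of_card_eq (by simp)
  refine ⟨⟨Matrix.of fun s k => b k s, ?_⟩, fun i s => ?_⟩
  · rw [mem_unitaryGroup_iff']
    ext i j
    have h := orthonormal_iff_ite.mp b.orthonormal i j
    rw [EuclideanSpace.inner_eq_star_dotProduct, dotProduct_comm] at h
    rw [Matrix.one_apply, ← h]
    rfl
  · simp [hb (e i) ⟨i, rfl⟩, hve]

/-- Unitary matrices map orthonormal families to arbitrary orthonormal families. -/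
theorem exists_unitary_mulVec_eq [DecidableEq B] [DecidableEq ι] {u v : ι → B → ℂ}
    (hu : IsOrthonormalFamily u) (hv : IsOrthonormalFamily v) (e : ι ↪ B) :
    ∃ W : unitaryGroup B ℂ, ∀ i, (W : Matrix B B ℂ) *ᵥ u i = v i := by
  have key {u : ι → B → ℂ} {W : unitaryGroup B ℂ}
      (h : ∀ i s, (W : Matrix B B ℂ) s (e i) = u i s) (i : ι) :
      (W : Matrix B B ℂ) *ᵥ Pi.single (e i) 1 = u i := by
    ext s
    simp [h]
  obtain ⟨X, hX⟩ := exists_unitary_columns hu e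
  obtain ⟨Y, hY⟩ := exists_unitary_columns hv e
  refine ⟨Y * star X, fun i => ?_⟩
  rw [← key hX, ← key hY, mulVec_mulVec, ← Submonoid.coe_mul, mul_assoc, Unitary.star_mul_self,
    mul_one]

end Unitary

/-! ### The algorithm built from phase queries. -/

open Matrix

/-- Every input position has an address in the index register. -/
theorem exists_address {n : ℕ} (i : Fin n) :
    ∃ a : Fin (Nat.clog 2 n) → Bool, Nat.ofBits a = i :=
  ⟨fun j => (i : ℕ).testBit j, by
    rw [Nat.ofBits_testBit, Nat.mod_eq_of_lt (i.isLt.trans_le (Nat.le_pow_clog one_lt_two n))]⟩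

/-- The contents of the index register for a query at `o`. -/
noncomputable def queryAddress {n : ℕ} (o : Option (Fin n)) : Fin (Nat.clog 2 n) → Bool :=
  o.elim (fun _ => false) fun i => (exists_address i).choose

/-- The state with `|-⟩` in the target register and the address of a query in the index register,
or with `|+⟩` in the target register when there is nothing to query. -/
noncomputable def queryVec {n w : ℕ} (o : Option (Fin n)) (b : Bool) (z : Fin w → Bool) :
    QBasis n w → ℂ :=
  (((√2)⁻¹ : ℝ) : ℂ) • (Pi.single (false, b, queryAddress o, false, z) 1 +
    o.elim (1 : ℂ) (fun _ => -1) • Pi.single (false, b, queryAddress o, true, z) 1)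

theorem oracle_mulVec_single {n w : ℕ} (x : Fin n → Bool) (s : QBasis n w) :
    oracle w x *ᵥ Pi.single s 1 = Pi.single (queryBasis x s) 1 := by
  ext s'
  simp [oracle, Pi.single_apply]

/-- Phase kickback: flipping the target negates `|-⟩`, while `|+⟩` is fixed whatever bit is read. -/
theorem oracle_mulVec_queryVec {n w : ℕ} (x : Fin n → Bool) (o : Option (Fin n)) (b : Bool)
    (z : Fin w → Bool) :
    oracle w x *ᵥ queryVec o b z = (queryPhase o x : ℂ) • queryVec o b z := by
  rw [queryVec, mulVec_smul, mulVec_add, mulVec_smul, oracle_mulVec_single, oracle_mulVec_single,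
    smul_comm]
  congr 1
  cases o with
  | none =>
    cases h : bitAt x (Nat.ofBits (queryAddress (none : Option (Fin n)))) <;>
      simp [queryBasis, queryPhase, h, add_comm]
  | some i =>
    have h : bitAt x (Nat.ofBits (queryAddress (some i))) = x i := by
      simp [queryAddress, (exists_address i).choose_spec, bitAt]
    cases hx : x i
    · simp [queryBasis, queryPhase, h, hx, bitVal]
    · simp [queryBasis, queryPhase, h, hx, bitVal]
      norm_num
      abel

theorem isOrthonormalFamily_queryVec {n w : ℕ} {L : Type*} [DecidableEq L] (o : L → Option (Fin n))
    (enc : L ↪ (Fin w → Bool)) :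
    IsOrthonormalFamily fun i : L × Bool => queryVec (o i.1) i.2 (enc i.1) := by
  have hs : (((√2)⁻¹ : ℝ) : ℂ) * (((√2)⁻¹ : ℝ) : ℂ) = 2⁻¹ := by
    rw [← Complex.ofReal_mul, ← mul_inv, Real.mul_self_sqrt zero_le_two]
    norm_num
  rintro ⟨l, b⟩ ⟨l', b'⟩
  by_cases h : (l, b) = (l', b')
  · obtain ⟨rfl, rfl⟩ := Prod.mk.inj h
    rw [if_pos rfl]
    have hphase : star ((o l).elim (1 : ℂ) fun _ => -1) * ((o l).elim (1 : ℂ) fun _ => -1) = 1 := by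
      cases o l <;> simp
    simp [queryVec, dotProduct_smul, dotProduct_add] at hs hphase ⊢
    linear_combination (2 : ℂ) * hs + (√2 : ℂ)⁻¹ * (√2 : ℂ)⁻¹ * hphase
  · rw [if_neg h]
    have h' : ∀ a a' t t', ((false, b, a, t, enc l) : QBasis n w) ≠ (false, b', a', t', enc l') := by
      intro a a' t t' e
      simp only [Prod.mk.injEq, enc.injective.eq_iff, true_and] at e
      exact h (Prod.ext e.2.2.2 e.1)
    simp [queryVec, dotProduct_smul, dotProduct_add, (h' _ _ _ _).symm]

theorem sum_smul_queryVec_apply_true {n w : ℕ} {L : Type*} [Fintype L] (o : L → Option (Fin n))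
    (enc : L → Fin w → Bool) (α : L × Bool → ℂ) (r) :
    (∑ i, α i • queryVec (o i.1) i.2 (enc i.1)) (true, r) = 0 := by
  simp [queryVec]

/-- Postselected amplitudes with values proportional to combinations of products of `d` phases can
be produced with `d` queries. -/
theorem exists_postselAlg_finalState {n d : ℕ} {L : Type*} [Fintype L]
    (idx : ℕ → L → Option (Fin n)) (c : L × Bool → ℝ) (hc : c ≠ 0) :
    ∃ A : PostselAlg n, A.queries = d ∧ ∃ κ : ℂ, κ ≠ 0 ∧ ∀ x b r,
      A.finalState x (true, b, r) = if r = (zeroBasis n A.work).2.2 then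
        κ * ((∑ l, c (l, b) * ∏ k ∈ Finset.range d, queryPhase (idx k l) x : ℝ) : ℂ) else 0 := by
  classical
  set w := Fintype.card L
  obtain ⟨enc⟩ : Nonempty (L ↪ (Fin w → Bool)) :=
    Function.Embedding.nonempty_of_card_le (by simpa [w] using Nat.lt_two_pow_self.le)
  let v (t : ℕ) (i : L × Bool) : QBasis n w → ℂ := queryVec (idx t i.1) i.2 (enc i.1)
  have hv (t : ℕ) : IsOrthonormalFamily (v t) := isOrthonormalFamily_queryVec (idx t) enc
  let e : L × Bool ↪ QBasis n w :=
    ⟨fun i => (false, i.2, fun _ => false, false, enc i.1), fun i j h => by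
      simp only [Prod.mk.injEq, enc.injective.eq_iff, true_and] at h
      exact Prod.ext h.2 h.1⟩
  -- `G t` replaces the query at step `t` by that at step `t + 1`, simultaneously on all branches.
  choose G hG using fun t => exists_unitary_mulVec_eq (hv t) (hv (t + 1)) e
  have hN : 0 < ∑ i, c i ^ 2 := by
    obtain ⟨i, hi⟩ := Function.ne_iff.mp hc
    exact Finset.sum_pos' (fun i _ => sq_nonneg _) ⟨i, Finset.mem_univ _, sq_pos_of_ne_zero hi⟩
  set N : ℝ := (√(∑ i, c i ^ 2))⁻¹ with hNdef
  have hN0 : N ≠ 0 := inv_ne_zero (Real.sqrt_ne_zero'.mpr hN)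
  have hNsq : N * N * ∑ i, c i ^ 2 = 1 := by
    rw [hNdef, ← mul_inv, Real.mul_self_sqrt hN.le, inv_mul_cancel₀ hN.ne']
  obtain ⟨U₀, hU₀⟩ := exists_unitary_columns
    (u := fun _ : Unit => ∑ i, ((N * c i : ℝ) : ℂ) • v 0 i) (fun _ _ => by
      rw [(hv 0).sum_dotProduct_sum, if_pos rfl]
      have h : ∀ i, star ((N * c i : ℝ) : ℂ) * ((N * c i : ℝ) : ℂ) = ((N * N * c i ^ 2 : ℝ) : ℂ) :=
        fun i => by
          rw [Complex.star_def, Complex.conj_ofReal, ← Complex.ofReal_mul]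
          congr 1
          ring
      simp_rw [h]
      rw [← Complex.ofReal_sum, ← Finset.mul_sum, hNsq, Complex.ofReal_one])
    ⟨fun _ => zeroBasis n w, fun _ _ _ => rfl⟩
  have hcard : (0 : ℝ) < Fintype.card L := by
    obtain ⟨i, -⟩ := Function.ne_iff.mp hc
    exact_mod_cast Fintype.card_pos_iff.mpr ⟨i.1⟩
  set K : ℝ := (√(Fintype.card L))⁻¹ with hKdef
  have hK0 : K ≠ 0 := inv_ne_zero (Real.sqrt_ne_zero'.mpr hcard)
  have hKsq : (Fintype.card L : ℂ) * ((K : ℂ) * K) = 1 := by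
    rw [← Complex.ofReal_mul, hKdef, ← mul_inv, Real.mul_self_sqrt hcard.le]
    push_cast
    exact mul_inv_cancel₀ (by exact_mod_cast hcard.ne')
  let a (b : Bool) (i : L × Bool) : ℂ := if i.2 = b then K else 0
  have ha (b : Bool) (β : L × Bool → ℂ) : ∑ i, star (a b i) * β i = K * ∑ l, β (l, b) := by
    rw [Fintype.sum_prod_type_right, Fintype.sum_eq_single b, Finset.mul_sum]
    · simp [a]
    · intro b' hb
      simp [a, hb]
  let r₀ := (zeroBasis n w).2.2
  let R := (Fin (Nat.clog 2 n) → Bool) × Bool × (Fin w → Bool)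
  -- `star V` will send `g j` to the basis state `(true, j)`. For `r₀` this extracts the sum over
  -- branches; the other `g j` have first qubit `true`, hence are orthogonal to every branch and
  -- receive no amplitude.
  let g (j : Bool × R) : QBasis n w → ℂ :=
    if j.2 = r₀ then ∑ i, a j.1 i • v d i else Pi.single (true, j) 1
  have hg : IsOrthonormalFamily g := by
    rintro ⟨b, r⟩ ⟨b', r'⟩
    by_cases hr : r = r₀ <;> by_cases hr' : r' = r₀
    · subst hr hr'
      simp only [g, if_true]
      rw [(hv d).sum_dotProduct_sum, ha]
      by_cases hb : b = b'
      · simpa [a, hb, mul_left_comm] using hKsq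
      · simp [a, hb]
    · have : r ≠ r' := fun h => hr' (h ▸ hr)
      simp only [g, hr, hr', if_true, if_false, dotProduct_single, mul_one, Pi.star_apply]
      rw [sum_smul_queryVec_apply_true (idx d) enc]
      simp [Ne.symm hr']
    · simp only [g, hr, hr', if_true, if_false, ← Pi.single_star, single_dotProduct]
      rw [sum_smul_queryVec_apply_true (idx d) enc]
      simp [hr]
    · simp [g, hr, hr', Pi.single_apply, eq_comm]
  obtain ⟨V, hV⟩ := exists_unitary_columns hg ⟨fun j => (true, j), fun _ _ h => (Prod.mk.inj h).2⟩
  let A : PostselAlg n :=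
    { work := w
      queries := d
      -- The final rotation is merged into the last unitary, which is the preparation itself when `d
      -- = 0`.
      U := fun t => (if t = d then star V else 1) * (if t = 0 then U₀ else G (t - 1)) }
  let ψ (x : Fin n → Bool) (t : ℕ) : QBasis n w → ℂ :=
    ∑ i, (((N * c i * ∏ k ∈ Finset.range t, queryPhase (idx k i.1) x : ℝ)) : ℂ) • v t i
  have hstate (x : Fin n → Bool) (t : ℕ) (ht : t ≤ d) : A.stateAfter x t =
      ((if t = d then star V else 1 : unitaryGroup (QBasis n w) ℂ) : Matrix _ _ ℂ) *ᵥ ψ x t := by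
    induction t with
    | zero =>
      have h : (U₀ : Matrix (QBasis n w) (QBasis n w) ℂ) *ᵥ Pi.single (zeroBasis n w) 1 = ψ x 0 := by
        ext s
        have h : (U₀ : Matrix (QBasis n w) (QBasis n w) ℂ) s (zeroBasis n w) =
          (∑ i, ((N * c i : ℝ) : ℂ) • v 0 i) s := hU₀ () s
        simpa [ψ] using h
      rw [PostselAlg.stateAfter, ← h]
      simp only [A, if_true, Submonoid.coe_mul, mulVec_mulVec]
    | succ t ih =>
      rw [PostselAlg.stateAfter, ih (by omega), if_neg (by omega)]
      have h : (G t : Matrix (QBasis n w) (QBasis n w) ℂ) *ᵥ (oracle w x *ᵥ ψ x t) =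
          ψ x (t + 1) := by
        simp only [ψ, mulVec_sum, mulVec_smul]
        refine Finset.sum_congr rfl fun i _ => ?_
        have h1 : oracle w x *ᵥ v t i = _ := oracle_mulVec_queryVec x _ _ _
        rw [h1, mulVec_smul, smul_smul, hG, Finset.prod_range_succ, ← mul_assoc,
          ← Complex.ofReal_mul]
      rw [← h]
      have hU : A.U (t + 1) = (if t + 1 = d then star V else 1) * G t := rfl
      rw [hU, Submonoid.coe_mul, ← mulVec_mulVec, OneMemClass.coe_one, one_mulVec]
  refine ⟨A, rfl, ((N * K : ℝ) : ℂ), by exact_mod_cast mul_ne_zero hN0 hK0, fun x b r => ?_⟩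
  have h1 : A.finalState x (true, b, r) = star (g (b, r)) ⬝ᵥ ψ x d := by
    rw [PostselAlg.finalState, hstate x d le_rfl, if_pos rfl, mulVec]
    congr 1
    ext s
    rw [Pi.star_apply, ← hV]
    rfl
  rw [h1]
  by_cases hr : r = r₀
  · rw [if_pos hr]
    simp only [g, hr, if_true, ψ]
    rw [(hv d).sum_dotProduct_sum, ha]
    push_cast
    rw [Finset.mul_sum, Finset.mul_sum]
    refine Finset.sum_congr rfl fun l _ => ?_
    ring
  · rw [if_neg hr]
    simp only [g, hr, if_false, ← Pi.single_star, single_dotProduct, ψ]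
    rw [sum_smul_queryVec_apply_true (idx d) enc, mul_zero]

/-! ### From rational representations to algorithms, and the equality. -/

theorem mem_postQueryCounts_of_rationalRepDegrees {n d : ℕ} {f : (Fin n → Bool) → Bool}
    (hd : d ∈ rationalRepDegrees f) : d ∈ postQueryCounts 0 f := by
  obtain ⟨p, q, ⟨-, -, hpq⟩, hd⟩ := hd
  have hp := eval_mem_cubePoly (p := p) (d := d) (hd ▸ le_max_left _ _)
  have hq := eval_mem_cubePoly (p := q) (d := d) (hd ▸ le_max_right _ _)
  obtain ⟨c₁, hc₁⟩ := exists_sum_queryChar hp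
  obtain ⟨c₀, hc₀⟩ := exists_sum_queryChar (Submodule.sub_mem _ hq hp)
  let c : (Fin d → Option (Fin n)) × Bool → ℝ := fun i => if i.2 then c₁ i.1 else c₀ i.1
  -- If all coefficients vanished, so would `q = p + (q - p)` on the cube.
  have hc : c ≠ 0 := by
    intro h
    have h₁ : ∀ l, c₁ l = 0 := fun l => congrFun h (l, true)
    have h₀ : ∀ l, c₀ l = 0 := fun l => congrFun h (l, false)
    have e₁ := hc₁ fun _ => false
    have e₀ := hc₀ fun _ => false
    simp only [h₁, h₀, zero_mul, Finset.sum_const_zero, Pi.sub_apply] at e₁ e₀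
    exact (hpq fun _ => false).1 (by linarith)
  obtain ⟨A, hA, κ, hκ, hfin⟩ := exists_postselAlg_finalState (d := d)
    -- The default `none` is reached only after the last query, in the family `v d`.
    (fun t (l : Fin d → Option (Fin n)) => if h : t < d then l ⟨t, h⟩ else none) c hc
  have hchar (l : Fin d → Option (Fin n)) (x : Fin n → Bool) : ∏ k ∈ Finset.range d,
      queryPhase (if h : k < d then l ⟨k, h⟩ else none) x = queryChar l x := by
    rw [Finset.prod_range, queryChar]
    exact Finset.prod_congr rfl fun k _ => by simp
  simp only [hchar] at hfin
  have hzero (x : Fin n → Bool) (b : Bool) :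
      A.jointProb x b = 0 ↔ ∑ l, c (l, b) * queryChar l x = 0 := by
    rw [PostselAlg.jointProb_eq_zero_iff]
    constructor
    · intro h
      have := h (true, b, (zeroBasis n A.work).2.2) rfl rfl
      rw [hfin, if_pos rfl, mul_eq_zero, Complex.ofReal_eq_zero] at this
      exact this.resolve_left hκ
    · rintro h ⟨_, _, r⟩ rfl rfl
      rw [hfin, h]
      simp
  refine ⟨A, (PostselAlg.computes_zero_iff A f).mpr fun x => ?_, hA.symm⟩
  obtain ⟨hq0, hf⟩ := hpq x
  rw [div_eq_iff hq0] at hf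
  have e₁ := hc₁ x
  have e₀ := hc₀ x
  rw [Pi.sub_apply] at e₀
  rw [Ne, hzero, hzero]
  cases hfx : f x
  · rw [hfx, show bitVal false = 0 from if_neg Bool.false_ne_true, zero_mul] at hf
    simp only [c, Bool.not_false, Bool.false_eq_true, if_true, if_false, ← e₀, ← e₁]
    exact ⟨by rwa [hf, sub_zero], hf⟩
  · rw [hfx, show bitVal true = 1 from if_pos rfl, one_mul] at hf
    simp only [c, Bool.not_true, Bool.false_eq_true, if_true, if_false, ← e₀, ← e₁]
    exact ⟨by rwa [hf], by rw [hf, sub_self]⟩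

theorem mainTheorem10 (n : ℕ) (hn : 0 < n) (f : (Fin n → Bool) → Bool) :
    (rationalRepDegrees f).Nonempty ∧ (postQueryCounts 0 f).Nonempty ∧
      rdeg f = PostQ 0 f := by
  have h1 := rationalRepDegrees_nonempty f
  have h2 : (postQueryCounts 0 f).Nonempty :=
    h1.mono fun _ => mem_postQueryCounts_of_rationalRepDegrees
  refine ⟨h1, h2, le_antisymm ?_ ?_⟩
  · obtain ⟨A, hA, hT⟩ := Nat.sInf_mem h2
    obtain ⟨e, he, hle⟩ := exists_rationalRepDegree_le_queries hA
    exact (Nat.sInf_le he).trans (hle.trans_eq hT.symm)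
  · exact Nat.sInf_le (mem_postQueryCounts_of_rationalRepDegrees (Nat.sInf_mem h1))
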